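/- Let $n$ be a number of bidders and let $D$ be a finite non-empty set of probability distributions on $[0,\infty)$. An ($n$-bidder) economy over $D$ assigns to each bidder $i\in\{1,\dots,n\}$ a distribution from $D$ (repetitions allowed), from which the value of bidder $i$ is drawn independently of the other bidders. The second-price revenue of an economy is the expectation, in $[0,\infty]$, of the second-highest of the $n$ values, counted with multiplicity ($0$ if $n\le 1$). The ideal second-price revenue of $D$ is the maximum of the second-price revenues of all $n$-bidder economies over $D$. There is a function $g:\mathbb R\to\mathbb R$ with $g(\varepsilon)=O(1/\varepsilon^{10})$ as $\varepsilon\to 0^+$ such that for every $\varepsilon>0$, every $n$ and every such $D$ there are a subset $D'\subseteq D$ with $|D'|\le (1/\varepsilon)^{g(\varepsilon)}$ and an $n$-bidder economy over $D'$ whose second-price revenue is at least $(1-\varepsilon)$ times the ideal second-price revenue of $D$. In particular the bound on $|D'|$ depends only on $\varepsilon$, not on $n$ or $D$. -/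

import Mathlib

open MeasureTheory Asymptotics
open scoped NNReal ENNReal Topology

noncomputable section

/-- The second-highest of the values `x 0, …, x (n-1)`, counted with multiplicity: the largest
number that is attained or exceeded by two different bidders. It is `0` if there are fewer than
two bidders. -/
def secondHighest {n : ℕ} (x : Fin n → ℝ≥0) : ℝ≥0 :=
  (Finset.univ : Finset (Fin n)).offDiag.sup fun p => min (x p.1) (x p.2)

/-- A positive number is at most the second-highest value iff at least two bidders reach it. -/
theorem le_secondHighest_iff {n : ℕ} (x : Fin n → ℝ≥0) {t : ℝ≥0} (ht : 0 < t) :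
    t ≤ secondHighest x ↔ 2 ≤ (Finset.univ.filter fun i => t ≤ x i).card := by
  rw [secondHighest, Finset.le_sup_iff (by simpa using ht)]
  change _ ↔ 1 < _
  rw [Finset.one_lt_card]
  constructor
  · rintro ⟨⟨i, j⟩, hp, h⟩
    exact ⟨i, by simpa using (le_min_iff.1 h).1, j, by simpa using (le_min_iff.1 h).2,
      (Finset.mem_offDiag.1 hp).2.2⟩
  · rintro ⟨i, hi, j, hj, hij⟩
    exact ⟨(i, j), by simpa using hij, le_min (by simpa using hi) (by simpa using hj)⟩

/-- An economy with `n` bidders: bidder `i` draws its nonnegative value from the distribution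
`E i`, independently of the other bidders. -/
abbrev Economy (n : ℕ) : Type := Fin n → ProbabilityMeasure ℝ≥0

/-- The revenue of the second-price auction: the expected second-highest value, a number
in `[0, ∞]`. -/
def Economy.spRevenue {n : ℕ} (E : Economy n) : ℝ≥0∞ :=
  ∫⁻ x, (secondHighest x : ℝ≥0∞) ∂(Measure.pi fun i => (E i : Measure ℝ≥0))

/-- The ideal second-price revenue: the maximum (over finitely many economies) of the
second-price revenue of an `n`-bidder economy all of whose distributions belong to `D`. -/
def idealSpRevenue (n : ℕ) (D : Finset (ProbabilityMeasure ℝ≥0)) : ℝ≥0∞ :=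
  ⨆ (E : Economy n) (_ : ∀ i, E i ∈ D), E.spRevenue

end

/-!
The statement holds with a bound `|D'| ≤ k ^ k ^ 7`, where `k` is about `1 / ε`.

For a distribution `F` write `q_F(t)` for its survival function, and for an economy let `P(t)` be
the probability that at least two bidders reach `t`, so that the revenue is `∫ P` over `(0, ∞)`
(`spRevenue_eq`). With `Q = ∑ q_i` the expected number of bidders reaching `t`, the probability
`P` is the Poisson value `ψ(Q) = 1 - (1 + Q) e^{-Q}` up to `2 ∑ q_i²`
(`poissonTwo_sub_le_twoReach`, `twoReach_le_poissonTwo_add`). Let `E` be an optimal economy and `R`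
its revenue. If `n < k ^ 25`, the distributions occurring in `E` form `D'`. If `R = ∞`, the copies
of a single distribution already have infinite revenue (`integrableOn_twoReach_of_copies`).

Otherwise optimality of `R` is applied to `n` copies of each `F ∈ D`: above the threshold
`T = k ^ 4 R` one has `n q_F ≤ 4 / k²`, and the square of the `L²(T, ∞)` norm of `q_F` is at most
`12 R / n²` (`mul_survival_sq_le`, `memLp_survival`). One of `k ^ 2` blocks of bidders can be
discarded at a loss of at most `2 R / k ^ 2` (`exists_block_integral_le`); let `S` be the set of
the others. The discarded bidders all receive one distribution `G`, chosen so that its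
copies alone make two bidders almost surely reach every grid point at which the copies of some
distribution of `D` would (`exists_saturating`). At the remaining points every `q_F` with `F ∈ D`
is `O(k ^ 9 / n)`; so it is enough to keep `Q`, the sum over `S`, up to a small
additive error at the points of a grid of step `R / k ^ 2`. Therefore `D` is divided into classes
according to the rounded values of `n q_F` at the grid points, and each bidder of `S` is moved to
the representative of its class.

Above `T` the probability `P` is essentially `Q² / 2`. This is convex in `Q`, so
`∫ Q'² ≥ 2 ∫ Q Q' - ∫ Q²`, and taking in each class a representative with the
largest value of the linear functional `∫ Q q_F` gives `∫ Q'² ≥ ∫ Q²`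
(`integral_twoReach_tail_le`).
-/

noncomputable section

/-! ### Poisson approximation of the probability of two successes -/

/-- The probability that a Poisson variable of mean `x` is at least two. -/
def poissonTwo (x : ℝ) : ℝ := 1 - (1 + x) * Real.exp (-x)

theorem hasDerivAt_poissonTwo (x : ℝ) : HasDerivAt poissonTwo (x * Real.exp (-x)) x := by
  have h1 : HasDerivAt (fun y : ℝ => Real.exp (-y)) (Real.exp (-x) * -1) x :=
    (hasDerivAt_neg x).exp
  have h2 : HasDerivAt (fun y : ℝ => 1 + y) 1 x := (hasDerivAt_id x).const_add 1
  exact ((h2.mul h1).const_sub 1).congr_deriv (by ring)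

/-- Monotonicity on the half-line, from a nonnegative derivative there. -/
theorem le_of_hasDerivAt_of_nonneg {f f' : ℝ → ℝ} (hf : ∀ x, HasDerivAt f (f' x) x)
    (hf' : ∀ x, 0 ≤ x → 0 ≤ f' x) {x y : ℝ} (hx : 0 ≤ x) (hxy : x ≤ y) : f x ≤ f y := by
  refine monotoneOn_of_deriv_nonneg (convex_Ici (0 : ℝ))
    (fun z _ => (hf z).continuousAt.continuousWithinAt)
    (fun z _ => (hf z).differentiableAt.differentiableWithinAt) (fun z hz => ?_)
    (Set.mem_Ici.2 hx) (Set.mem_Ici.2 (hx.trans hxy)) hxy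
  rw [interior_Ici] at hz
  rw [(hf z).deriv]
  exact hf' z (le_of_lt hz)

theorem poissonTwo_mono {x y : ℝ} (hx : 0 ≤ x) (hxy : x ≤ y) : poissonTwo x ≤ poissonTwo y :=
  le_of_hasDerivAt_of_nonneg hasDerivAt_poissonTwo (fun z hz => by positivity) hx hxy

theorem poissonTwo_zero : poissonTwo 0 = 0 := by simp [poissonTwo]

theorem poissonTwo_le_add {x y : ℝ} (hx : 0 ≤ x) (hxy : x ≤ y) :
    poissonTwo y ≤ poissonTwo x + (y - x) := by
  have h : ∀ z : ℝ, HasDerivAt (fun z => z - poissonTwo z) (1 - z * Real.exp (-z)) z :=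
    fun z => (hasDerivAt_id z).sub (hasDerivAt_poissonTwo z)
  have := le_of_hasDerivAt_of_nonneg h (fun z hz => ?_) hx hxy
  · linarith
  · have h1 : z * Real.exp (-z) ≤ Real.exp z * Real.exp (-z) :=
      mul_le_mul_of_nonneg_right (by linarith [Real.add_one_le_exp z]) (Real.exp_pos _).le
    rw [← Real.exp_add, add_neg_cancel, Real.exp_zero] at h1
    linarith

theorem poissonTwo_le_sq {x : ℝ} (hx : 0 ≤ x) : poissonTwo x ≤ x ^ 2 / 2 := by
  have h : ∀ z : ℝ, HasDerivAt (fun z => z ^ 2 / 2 - poissonTwo z) (z - z * Real.exp (-z)) z :=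
    fun z => (((hasDerivAt_pow 2 z).div_const 2).sub
      (hasDerivAt_poissonTwo z)).congr_deriv (by push_cast; ring)
  have := le_of_hasDerivAt_of_nonneg h (fun z hz => ?_) le_rfl hx
  · simp only [poissonTwo_zero] at this
    linarith
  · have : Real.exp (-z) ≤ 1 := Real.exp_le_one_iff.2 (by linarith)
    nlinarith

theorem sq_le_poissonTwo {x : ℝ} (hx : 0 ≤ x) : x ^ 2 / 2 - x ^ 3 / 3 ≤ poissonTwo x := by
  have h : ∀ z : ℝ, HasDerivAt (fun z => poissonTwo z - (z ^ 2 / 2 - z ^ 3 / 3))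
      (z * Real.exp (-z) - (z - z ^ 2)) z :=
    fun z => ((hasDerivAt_poissonTwo z).sub (((hasDerivAt_pow 2 z).div_const 2).sub
      ((hasDerivAt_pow 3 z).div_const 3))).congr_deriv (by push_cast; ring)
  have := le_of_hasDerivAt_of_nonneg h (fun z hz => ?_) le_rfl hx
  · simp only [poissonTwo_zero] at this
    linarith
  · have : 1 - z ≤ Real.exp (-z) := by linarith [Real.add_one_le_exp (-z)]
    nlinarith

/-- The probability that at least two of independent events, indexed by `S` and of
probabilities `q i`, occur. -/
def bernoulliTwo {ι : Type*} [DecidableEq ι] (S : Finset ι) (q : ι → ℝ) : ℝ :=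
  1 - (∏ i ∈ S, (1 - q i) + ∑ i ∈ S, q i * ∏ j ∈ S.erase i, (1 - q j))

theorem prod_one_sub_le_exp {ι : Type*} (S : Finset ι) (q : ι → ℝ) (h1 : ∀ i ∈ S, q i ≤ 1) :
    ∏ i ∈ S, (1 - q i) ≤ Real.exp (-∑ i ∈ S, q i) := by
  rw [← Finset.sum_neg_distrib, Real.exp_sum]
  exact Finset.prod_le_prod (fun i hi => by linarith [h1 i hi])
    fun i _ => by linarith [Real.add_one_le_exp (-q i)]

theorem one_sub_sum_le_prod_one_sub {ι : Type*} (S : Finset ι) (a : ι → ℝ)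
    (h0 : ∀ i ∈ S, 0 ≤ a i) (h1 : ∀ i ∈ S, a i ≤ 1) :
    1 - ∑ i ∈ S, a i ≤ ∏ i ∈ S, (1 - a i) := by
  classical
  induction S using Finset.induction_on with
  | empty => simp
  | insert i S hi ih =>
    rw [Finset.sum_insert hi, Finset.prod_insert hi]
    have := ih (fun j hj => h0 j (Finset.mem_insert_of_mem hj))
      fun j hj => h1 j (Finset.mem_insert_of_mem hj)
    have hs : 0 ≤ ∑ j ∈ S, a j := Finset.sum_nonneg fun j hj => h0 j (Finset.mem_insert_of_mem hj)
    have hi0 := h0 i (Finset.mem_insert_self i S)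
    have hi1 := h1 i (Finset.mem_insert_self i S)
    nlinarith

/-- Poisson approximation from below. It needs no smallness of the `q i`, because
`e ^ q ≤ 1 + 2 q` for `q ≤ 1`; the factor `exp (-Q)` keeps it useful when `Q` is large. -/
theorem le_bernoulliTwo {ι : Type*} [DecidableEq ι] (S : Finset ι)
    (q : ι → ℝ) (h0 : ∀ i ∈ S, 0 ≤ q i)
    (h1 : ∀ i ∈ S, q i ≤ 1) :
    poissonTwo (∑ i ∈ S, q i) - 2 * (∑ i ∈ S, q i ^ 2) * Real.exp (-∑ i ∈ S, q i)
      ≤ bernoulliTwo S q := by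
  set X := Real.exp (-∑ i ∈ S, q i) with hX
  have hX0 : 0 < X := Real.exp_pos _
  have hA : ∏ i ∈ S, (1 - q i) ≤ X := prod_one_sub_le_exp S q h1
  have hB : ∑ i ∈ S, q i * ∏ j ∈ S.erase i, (1 - q j)
      ≤ ∑ i ∈ S, (q i + 2 * q i ^ 2) * X := by
    refine Finset.sum_le_sum fun i hi => ?_
    have hq0 := h0 i hi
    have hq1 := h1 i hi
    have e1 : ∏ j ∈ S.erase i, (1 - q j) ≤ Real.exp (q i) * X := by
      refine (prod_one_sub_le_exp _ q fun j hj => h1 j (Finset.mem_of_mem_erase hj)).trans_eq ?_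
      rw [hX, ← Real.exp_add, ← Finset.add_sum_erase S q hi]
      congr 1
      ring
    have e2 : Real.exp (q i) ≤ 1 + 2 * q i := by
      have := Real.abs_exp_sub_one_le (x := q i) (by rw [abs_of_nonneg hq0]; exact hq1)
      rw [abs_of_nonneg hq0] at this
      linarith [le_abs_self (Real.exp (q i) - 1)]
    calc q i * ∏ j ∈ S.erase i, (1 - q j) ≤ q i * ((1 + 2 * q i) * X) := by
          gcongr
          exact e1.trans (by gcongr)
      _ = _ := by ring
  rw [← Finset.sum_mul, Finset.sum_add_distrib, ← Finset.mul_sum] at hB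
  unfold bernoulliTwo poissonTwo
  rw [← hX]
  nlinarith

/-- Poisson approximation from above, based on `1 - q ≥ (1 - q²) e^{-q}`. -/
theorem bernoulliTwo_le {ι : Type*} [DecidableEq ι] (S : Finset ι)
    (q : ι → ℝ) (h0 : ∀ i ∈ S, 0 ≤ q i)
    (h1 : ∀ i ∈ S, q i ≤ 1) :
    bernoulliTwo S q ≤ poissonTwo (∑ i ∈ S, q i) + ∑ i ∈ S, q i ^ 2 := by
  set X := Real.exp (-∑ i ∈ S, q i) with hX
  have hX0 : 0 < X := Real.exp_pos _
  set Q := ∑ i ∈ S, q i with hQ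
  have hQ0 : 0 ≤ Q := Finset.sum_nonneg h0
  have hs0 : 0 ≤ ∑ i ∈ S, q i ^ 2 := Finset.sum_nonneg fun i _ => sq_nonneg _
  have hXQ : (1 + Q) * X ≤ 1 := by
    have : (1 + Q) * X ≤ Real.exp Q * X := by
      gcongr
      linarith [Real.add_one_le_exp Q]
    rwa [hX, ← Real.exp_add, add_neg_cancel, Real.exp_zero] at this
  have hA : X * (1 - ∑ i ∈ S, q i ^ 2) ≤ ∏ i ∈ S, (1 - q i) := by
    calc X * (1 - ∑ i ∈ S, q i ^ 2) ≤ X * ∏ i ∈ S, (1 - q i ^ 2) := by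
          gcongr
          exact one_sub_sum_le_prod_one_sub S _ (fun i _ => sq_nonneg _) fun i hi =>
            by nlinarith [h0 i hi, h1 i hi]
      _ = ∏ i ∈ S, (Real.exp (-q i) * (1 - q i ^ 2)) := by
          rw [Finset.prod_mul_distrib, hX, hQ, ← Finset.sum_neg_distrib, Real.exp_sum]
      _ ≤ _ := by
          refine Finset.prod_le_prod (fun i hi => ?_) fun i hi => ?_
          · have := h0 i hi
            have := h1 i hi
            have : 0 ≤ 1 - q i ^ 2 := by nlinarith
            positivity
          · have e : Real.exp (-q i) * (1 + q i) ≤ 1 := by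
              have : Real.exp (-q i) * (1 + q i) ≤ Real.exp (-q i) * Real.exp (q i) := by
                gcongr
                linarith [Real.add_one_le_exp (q i)]
              rwa [← Real.exp_add, neg_add_cancel, Real.exp_zero] at this
            nlinarith [h1 i hi]
  have hP0 : 0 ≤ ∏ i ∈ S, (1 - q i) := Finset.prod_nonneg fun i hi => by linarith [h1 i hi]
  have hB : Q * ∏ i ∈ S, (1 - q i) ≤ ∑ i ∈ S, q i * ∏ j ∈ S.erase i, (1 - q j) := by
    rw [hQ, Finset.sum_mul]
    refine Finset.sum_le_sum fun i hi => mul_le_mul_of_nonneg_left ?_ (h0 i hi)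
    rw [← Finset.mul_prod_erase S _ hi]
    exact mul_le_of_le_one_left (Finset.prod_nonneg fun j hj => by
      linarith [h1 j (Finset.mem_of_mem_erase hj)]) (by linarith [h0 i hi])
  unfold bernoulliTwo poissonTwo
  rw [← hX]
  nlinarith [mul_le_mul_of_nonneg_left hA (by linarith : 0 ≤ 1 + Q),
    mul_le_mul_of_nonneg_right hXQ hs0]

/-- Saturation: once the expected number of events is large, two of them occur with probability
close to one. -/
theorem one_sub_le_bernoulliTwo {ι : Type*} [DecidableEq ι] (S : Finset ι)
    (q : ι → ℝ) (h0 : ∀ i ∈ S, 0 ≤ q i)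
    (h1 : ∀ i ∈ S, q i ≤ 1) {b : ℝ} (hb : 1 ≤ b) (hbq : b ≤ ∑ i ∈ S, q i) :
    1 - 8 / b ≤ bernoulliTwo S q := by
  have h := le_bernoulliTwo S q h0 h1
  set Q := ∑ i ∈ S, q i with hQ
  have hs : ∑ i ∈ S, q i ^ 2 ≤ Q := Finset.sum_le_sum fun i hi => by nlinarith [h0 i hi, h1 i hi]
  have hQ0 : 0 < Q := by linarith
  have he : Real.exp (-Q) ≤ 2 / Q ^ 2 := by
    rw [Real.exp_neg, inv_le_comm₀ (Real.exp_pos _) (by positivity), inv_div]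
    linarith [Real.quadratic_le_exp_of_nonneg hQ0.le]
  have : (1 + 3 * Q) * Real.exp (-Q) ≤ 8 / b := by
    calc (1 + 3 * Q) * Real.exp (-Q) ≤ (4 * Q) * (2 / Q ^ 2) := by gcongr; linarith
      _ = 8 / Q := by field_simp; norm_num
      _ ≤ _ := by gcongr
  unfold poissonTwo at h
  nlinarith [Real.exp_pos (-Q)]

/-- Many copies of one event: quadratic growth until saturation. -/
theorem min_sq_le_bernoulliTwo {ι : Type*} [DecidableEq ι] (S : Finset ι)
    (hS : 24 ≤ S.card) {p : ℝ} (h0 : 0 ≤ p)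
    (h1 : p ≤ 1) : min 1 ((S.card * p) ^ 2) / 12 ≤ bernoulliTwo S fun _ => p := by
  have h := le_bernoulliTwo S (fun _ => p) (fun _ _ => h0) (fun _ _ => h1)
  simp only [Finset.sum_const, nsmul_eq_mul] at h
  set x := (S.card : ℝ) * p with hx
  have hS' : (24 : ℝ) ≤ S.card := by exact_mod_cast hS
  have hx0 : 0 ≤ x := by positivity
  have hsq : 2 * ((S.card : ℝ) * p ^ 2) ≤ x ^ 2 / 12 := by
    rw [hx]
    nlinarith [mul_nonneg (sq_nonneg p) (by linarith : (0:ℝ) ≤ S.card)]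
  have hE := Real.exp_pos (-x)
  rcases le_total x 1 with hx1 | hx1
  · have hE1 : Real.exp (-x) ≤ 1 := Real.exp_le_one_iff.2 (by linarith)
    have := sq_le_poissonTwo hx0
    have h3 : x ^ 3 ≤ x ^ 2 := pow_le_pow_of_le_one hx0 hx1 (by norm_num)
    have h4 : 2 * ((S.card : ℝ) * p ^ 2) * Real.exp (-x) ≤ x ^ 2 / 12 :=
      (mul_le_of_le_one_right (by positivity) hE1).trans hsq
    have : min 1 (x ^ 2) ≤ x ^ 2 := min_le_right _ _
    linarith
  · have hm := poissonTwo_mono zero_le_one hx1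
    have h2 : (1 / 4 : ℝ) ≤ poissonTwo 1 := by
      unfold poissonTwo
      rw [Real.exp_neg]
      have : (Real.exp 1)⁻¹ ≤ (2.7)⁻¹ := by
        gcongr
        linarith [Real.exp_one_gt_d9]
      norm_num at this ⊢
      linarith
    have h3 : x ^ 2 * Real.exp (-x) ≤ 2 := by
      have e : x ^ 2 * Real.exp (-x) ≤ 2 * Real.exp x * Real.exp (-x) := by
        gcongr
        linarith [Real.quadratic_le_exp_of_nonneg hx0]
      rwa [mul_assoc, ← Real.exp_add, add_neg_cancel, Real.exp_zero, mul_one] at e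
    have h4 : 2 * ((S.card : ℝ) * p ^ 2) * Real.exp (-x) ≤ 1 / 6 := by
      have := mul_le_mul_of_nonneg_right hsq hE.le
      linarith
    have : min 1 (x ^ 2) ≤ 1 := min_le_left _ _
    linarith

/-! ### Survival functions and the revenue as a tail integral -/

/-- The survival function of a distribution: the probability that the value is at least `t`. -/
def survival (F : ProbabilityMeasure ℝ≥0) (t : ℝ) : ℝ :=
  (F : Measure ℝ≥0).real {x | t ≤ (x : ℝ)}

/-- The probability that at least two bidders of `S` have value at least `t`. -/
def twoReach {n : ℕ} (E : Economy n) (S : Finset (Fin n)) (t : ℝ) : ℝ :=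
  (Measure.pi fun i => (E i : Measure ℝ≥0)).real
    {x | 2 ≤ (S.filter fun i => t ≤ (x i : ℝ)).card}

theorem survival_nonneg (F : ProbabilityMeasure ℝ≥0) (t : ℝ) : 0 ≤ survival F t :=
  measureReal_nonneg

theorem survival_le_one (F : ProbabilityMeasure ℝ≥0) (t : ℝ) : survival F t ≤ 1 :=
  measureReal_le_one

theorem survival_antitone (F : ProbabilityMeasure ℝ≥0) : Antitone (survival F) :=
  fun _ _ h => measureReal_mono fun _ hx => le_trans h hx

theorem twoReach_nonneg {n : ℕ} (E : Economy n) (S : Finset (Fin n)) (t : ℝ) :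
    0 ≤ twoReach E S t :=
  measureReal_nonneg

theorem twoReach_le_one {n : ℕ} (E : Economy n) (S : Finset (Fin n)) (t : ℝ) :
    twoReach E S t ≤ 1 :=
  measureReal_le_one

theorem twoReach_antitone {n : ℕ} (E : Economy n) (S : Finset (Fin n)) :
    Antitone (twoReach E S) :=
  fun _ _ h => measureReal_mono fun _ hx => le_trans hx <|
    Finset.card_le_card <| Finset.monotone_filter_right _ fun _ _ hi => h.trans hi

theorem twoReach_mono {n : ℕ} (E : Economy n) {S S' : Finset (Fin n)} (h : S ⊆ S') (t : ℝ) :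
    twoReach E S t ≤ twoReach E S' t :=
  measureReal_mono fun _ hx => le_trans hx <| Finset.card_le_card <| Finset.filter_subset_filter _ h

theorem measurableSet_reach (t : ℝ) : MeasurableSet {x : ℝ≥0 | t ≤ (x : ℝ)} :=
  measurableSet_le measurable_const measurable_coe_nnreal_real

theorem measurableSet_filter_eq {n : ℕ} (S A : Finset (Fin n)) (t : ℝ) :
    MeasurableSet {x : Fin n → ℝ≥0 | S.filter (fun i => t ≤ (x i : ℝ)) = A} := by
  have : {x : Fin n → ℝ≥0 | S.filter (fun i => t ≤ (x i : ℝ)) = A}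
      = ⋂ i : Fin n, {x | (i ∈ S ∧ t ≤ (x i : ℝ)) ↔ i ∈ A} := by
    ext x
    simp [Finset.ext_iff]
  rw [this]
  refine MeasurableSet.iInter fun i => ?_
  have h : MeasurableSet {x : Fin n → ℝ≥0 | t ≤ (x i : ℝ)} :=
    measurableSet_le measurable_const (measurable_coe_nnreal_real.comp (measurable_pi_apply i))
  exact (measurableSet_setOfPred.2 ((Measurable.and measurable_const (measurableSet_setOfPred.1 h)).iff
    measurable_const))

/-- The bidders of `S` reaching `t` are exactly those of `A` with the product probability. -/
theorem measureReal_filter_eq {n : ℕ} (E : Economy n) {S A : Finset (Fin n)} (hA : A ⊆ S)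
    (t : ℝ) :
    (Measure.pi fun i => (E i : Measure ℝ≥0)).real
        {x | S.filter (fun i => t ≤ (x i : ℝ)) = A}
      = (∏ i ∈ A, survival (E i) t) * ∏ i ∈ S \ A, (1 - survival (E i) t) := by
  have hset : {x : Fin n → ℝ≥0 | S.filter (fun i => t ≤ (x i : ℝ)) = A}
      = Set.univ.pi fun i => if i ∈ A then {x : ℝ≥0 | t ≤ (x : ℝ)} else
          if i ∈ S \ A then {x : ℝ≥0 | t ≤ (x : ℝ)}ᶜ else Set.univ := by
    ext x
    simp only [Set.mem_ofPred_eq, Finset.ext_iff, Finset.mem_filter, Set.mem_univ_pi,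
      Finset.mem_sdiff]
    refine forall_congr' fun i => ?_
    by_cases h1 : i ∈ A
    · simp [h1, hA h1]
    · by_cases h2 : i ∈ S <;> simp [h1, h2]
  have hcompl : ∀ i, (E i : Measure ℝ≥0).real {x : ℝ≥0 | t ≤ (x : ℝ)}ᶜ = 1 - survival (E i) t :=
    fun i => by
      rw [measureReal_compl (measurableSet_reach t), survival]
      simp
  rw [hset, measureReal_def, Measure.pi_pi, ENNReal.toReal_prod]
  have : ∀ i : Fin n, ((E i : Measure ℝ≥0) (if i ∈ A then {x : ℝ≥0 | t ≤ (x : ℝ)} else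
          if i ∈ S \ A then {x : ℝ≥0 | t ≤ (x : ℝ)}ᶜ else Set.univ)).toReal
      = (if i ∈ A then survival (E i) t else 1) *
        (if i ∈ S \ A then 1 - survival (E i) t else 1) := by
    intro i
    by_cases h1 : i ∈ A
    · simp [h1, survival, measureReal_def]
    · by_cases h2 : i ∈ S
      · simpa [h1, h2, measureReal_def] using hcompl i
      · simp [h1, h2]
  rw [Finset.prod_congr rfl fun i _ => this i, Finset.prod_mul_distrib]
  simp only [Finset.prod_ite_mem, Finset.univ_inter]

/-- At most one bidder reaches `t` iff the set of those who do is empty or a singleton. -/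
theorem setOf_two_le_compl {n : ℕ} (S : Finset (Fin n)) (t : ℝ) :
    {x : Fin n → ℝ≥0 | 2 ≤ (S.filter fun i => t ≤ (x i : ℝ)).card}ᶜ
      = ⋃ A ∈ insert ∅ (S.map ⟨fun i => ({i} : Finset (Fin n)), Finset.singleton_injective⟩),
        {x | S.filter (fun i => t ≤ (x i : ℝ)) = A} := by
    ext x
    simp only [Set.mem_compl_iff, Set.mem_ofPred_eq, not_le, Set.mem_iUnion, Finset.mem_insert,
      Finset.mem_map, Function.Embedding.coeFn_mk, exists_prop, exists_eq_right']
    rw [Nat.lt_succ_iff, Nat.le_one_iff_eq_zero_or_eq_one, Finset.card_eq_zero, Finset.card_eq_one]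
    refine or_congr Iff.rfl ⟨fun ⟨i, hi⟩ => ⟨i, ?_, hi.symm⟩, fun ⟨i, _, hi⟩ => ⟨i, hi.symm⟩⟩
    exact Finset.mem_of_mem_filter i (hi ▸ Finset.mem_singleton_self i)

theorem measurableSet_two_le {n : ℕ} (S : Finset (Fin n)) (t : ℝ) :
    MeasurableSet {x : Fin n → ℝ≥0 | 2 ≤ (S.filter fun i => t ≤ (x i : ℝ)).card} := by
  refine MeasurableSet.of_compl ?_
  rw [setOf_two_le_compl]
  exact Finset.measurableSet_biUnion _ fun A _ => measurableSet_filter_eq S A t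

/-- By independence, `twoReach` is the probability that two of independent events of
probabilities `survival (E i) t` occur. -/
theorem twoReach_eq {n : ℕ} (E : Economy n) (S : Finset (Fin n)) (t : ℝ) :
    twoReach E S t = bernoulliTwo S fun i => survival (E i) t := by
  have h1 : twoReach E S t = 1 - (Measure.pi fun i => (E i : Measure ℝ≥0)).real
      {x : Fin n → ℝ≥0 | 2 ≤ (S.filter fun i => t ≤ (x i : ℝ)).card}ᶜ := by
    rw [measureReal_compl (measurableSet_two_le S t)]
    simp [twoReach]
  rw [h1, setOf_two_le_compl, measureReal_biUnion_finset, bernoulliTwo, Finset.sum_insert,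
    Finset.sum_map]
  · congr 2
    · rw [measureReal_filter_eq E (Finset.empty_subset S)]
      simp
    · refine Finset.sum_congr rfl fun i hi => ?_
      simp only [Function.Embedding.coeFn_mk]
      rw [measureReal_filter_eq E (Finset.singleton_subset_iff.2 hi)]
      simp [Finset.sdiff_singleton_eq_erase]
  · simp
  · intro A _ B _ hAB
    exact Set.disjoint_left.2 fun x (hx : _ = A) (hx' : _ = B) => hAB (hx.symm.trans hx')
  · exact fun A _ => measurableSet_filter_eq S A t

theorem measurable_secondHighest {n : ℕ} :
    Measurable fun x : Fin n → ℝ≥0 => secondHighest x := by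
  unfold secondHighest
  induction (Finset.univ : Finset (Fin n)).offDiag using Finset.induction_on with
  | empty => simp
  | insert p s hp ih =>
    simp only [Finset.sup_insert]
    exact ((measurable_pi_apply p.1).min (measurable_pi_apply p.2)).sup ih

/-- The revenue, as the integral of the tail of the second-highest value. -/
theorem spRevenue_eq {n : ℕ} (E : Economy n) :
    E.spRevenue = ∫⁻ t in Set.Ioi (0 : ℝ), ENNReal.ofReal (twoReach E Finset.univ t) := by
  have h := lintegral_eq_lintegral_meas_le (Measure.pi fun i => (E i : Measure ℝ≥0))
    (f := fun x => (secondHighest x : ℝ)) (Filter.Eventually.of_forall fun x => NNReal.coe_nonneg _)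
    (measurable_coe_nnreal_real.comp measurable_secondHighest).aemeasurable
  simp only [ENNReal.ofReal_coe_nnreal] at h
  rw [Economy.spRevenue, h]
  refine setLIntegral_congr_fun measurableSet_Ioi fun t (ht : 0 < t) => ?_
  simp only [twoReach]
  rw [ofReal_measureReal]
  congr 1
  ext x
  lift t to ℝ≥0 using ht.le
  simp only [Set.mem_ofPred_eq, NNReal.coe_le_coe]
  exact le_secondHighest_iff x (by exact_mod_cast ht)

theorem poissonTwo_sub_le_twoReach {n : ℕ} (E : Economy n) (S : Finset (Fin n)) (t : ℝ) :
    poissonTwo (∑ i ∈ S, survival (E i) t) - 2 * ∑ i ∈ S, survival (E i) t ^ 2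
      ≤ twoReach E S t := by
  rw [twoReach_eq]
  refine le_trans ?_ (le_bernoulliTwo S _ (fun i _ => survival_nonneg _ _)
    fun i _ => survival_le_one _ _)
  have h1 : Real.exp (-∑ i ∈ S, survival (E i) t) ≤ 1 :=
    Real.exp_le_one_iff.2 (neg_nonpos.2 (Finset.sum_nonneg fun i _ => survival_nonneg _ _))
  have h2 : 0 ≤ ∑ i ∈ S, survival (E i) t ^ 2 := Finset.sum_nonneg fun i _ => sq_nonneg _
  nlinarith

theorem twoReach_le_poissonTwo_add {n : ℕ} (E : Economy n) (S : Finset (Fin n)) (t : ℝ) :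
    twoReach E S t
      ≤ poissonTwo (∑ i ∈ S, survival (E i) t) + ∑ i ∈ S, survival (E i) t ^ 2 := by
  rw [twoReach_eq]
  exact bernoulliTwo_le S _ (fun i _ => survival_nonneg _ _) fun i _ => survival_le_one _ _

theorem one_sub_le_twoReach {n : ℕ} (E : Economy n) (S : Finset (Fin n)) (t : ℝ) {b : ℝ}
    (hb : 1 ≤ b) (hbq : b ≤ ∑ i ∈ S, survival (E i) t) : 1 - 8 / b ≤ twoReach E S t := by
  rw [twoReach_eq]
  exact one_sub_le_bernoulliTwo S _ (fun i _ => survival_nonneg _ _)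
    (fun i _ => survival_le_one _ _) hb hbq

theorem min_sq_le_twoReach {n : ℕ} (hn : 24 ≤ n) (F : ProbabilityMeasure ℝ≥0) (t : ℝ) :
    min 1 ((n * survival F t) ^ 2) / 12
      ≤ twoReach (fun _ : Fin n => F) Finset.univ t := by
  rw [twoReach_eq]
  simpa using min_sq_le_bernoulliTwo (Finset.univ : Finset (Fin n)) (by simpa using hn)
    (survival_nonneg F t) (survival_le_one F t)

theorem integrableOn_twoReach {n : ℕ} {E : Economy n}
    (hE : IntegrableOn (twoReach E Finset.univ) (Set.Ioi 0)) (S : Finset (Fin n)) :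
    IntegrableOn (twoReach E S) (Set.Ioi 0) :=
  Integrable.mono' hE (twoReach_antitone E S).measurable.aestronglyMeasurable
    (Filter.Eventually.of_forall fun t => by
      rw [Real.norm_of_nonneg (twoReach_nonneg _ _ _)]
      exact twoReach_mono E (Finset.subset_univ S) t)

/-- Discarding one of `L` blocks of bidders, suitably chosen, loses at most the fraction `2 / L`
of the revenue: only the blocks of the two highest bidders matter. -/
theorem exists_block_integral_le {n : ℕ} (E : Economy n)
    (hE : IntegrableOn (twoReach E Finset.univ) (Set.Ioi 0)) {L : ℕ} (hL : 0 < L)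
    (f : Fin n → Fin L) :
    ∃ l, (1 - 2 / (L : ℝ)) * ∫ t in Set.Ioi 0, twoReach E Finset.univ t
      ≤ ∫ t in Set.Ioi 0, twoReach E (Finset.univ.filter fun i => f i ≠ l) t := by
  have hint := integrableOn_twoReach hE
  have hpt : ∀ t, ((L : ℝ) - 2) * twoReach E Finset.univ t
      ≤ ∑ l, twoReach E (Finset.univ.filter fun i => f i ≠ l) t := by
    intro t
    set μ := Measure.pi fun i => (E i : Measure ℝ≥0)
    set A : Finset (Fin n) → Set (Fin n → ℝ≥0) :=
      fun S => {x | 2 ≤ (S.filter fun i => t ≤ (x i : ℝ)).card} with hA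
    have hi : ∀ S, Integrable ((A S).indicator (1 : (Fin n → ℝ≥0) → ℝ)) μ := fun S =>
      (integrable_const (1 : ℝ)).indicator (measurableSet_two_le S t)
    have he : ∀ S, twoReach E S t = ∫ x, (A S).indicator (1 : (Fin n → ℝ≥0) → ℝ) x ∂μ := fun S =>
      (integral_indicator_one (measurableSet_two_le S t)).symm
    simp only [he]
    rw [← integral_const_mul, ← integral_finsetSum _ fun l _ => hi _]
    refine integral_mono ((hi _).const_mul _) (integrable_finsetSum _ fun l _ => hi _) fun x => ?_
    by_cases hx : x ∈ A Finset.univ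
    · obtain ⟨i, hi, j, hj, hij⟩ := Finset.one_lt_card.1 (show 1 < _ from hx)
      have hl : ∀ l ∈ (Finset.univ \ {f i, f j} : Finset (Fin L)),
          x ∈ A (Finset.univ.filter fun i => f i ≠ l) := by
        intro l hl
        simp only [Finset.mem_sdiff, Finset.mem_univ, true_and, Finset.mem_insert,
          Finset.mem_singleton, not_or] at hl
        simp only [Finset.mem_filter, Finset.mem_univ, true_and] at hi hj
        exact Finset.one_lt_card.2 ⟨i, by simp [hi, Ne.symm hl.1], j, by simp [hj, Ne.symm hl.2],
          hij⟩
      have hc : (L : ℝ) - 2 ≤ (Finset.univ \ {f i, f j} : Finset (Fin L)).card := by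
        have h1 := Finset.le_card_sdiff ({f i, f j} : Finset (Fin L)) Finset.univ
        have h2 := Finset.card_le_two (a := f i) (b := f j)
        rw [Finset.card_univ, Fintype.card_fin] at h1
        have : (L : ℝ) ≤ (Finset.univ \ {f i, f j} : Finset (Fin L)).card + 2 := by
          exact_mod_cast (by omega)
        linarith
      -- All blocks but those of the reaching bidders `i` and `j` may be discarded.
      calc ((L : ℝ) - 2) * (A Finset.univ).indicator 1 x = (L : ℝ) - 2 := by
            simp [Set.indicator_of_mem hx]
        _ ≤ ∑ l ∈ (Finset.univ \ {f i, f j} : Finset (Fin L)), (1 : ℝ) := by simpa using hc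
        _ = ∑ l ∈ (Finset.univ \ {f i, f j} : Finset (Fin L)),
              (A (Finset.univ.filter fun i => f i ≠ l)).indicator 1 x :=
            Finset.sum_congr rfl fun l h => by rw [Set.indicator_of_mem (hl l h)]; rfl
        _ ≤ _ := Finset.sum_le_sum_of_subset_of_nonneg (Finset.subset_univ _) fun l _ _ =>
            Set.indicator_nonneg (fun _ _ => zero_le_one) _
    · rw [Set.indicator_of_notMem hx, mul_zero]
      exact Finset.sum_nonneg fun l _ => Set.indicator_nonneg (fun _ _ => zero_le_one) _
  by_contra! hcon
  have h1 := setIntegral_mono (s := Set.Ioi (0 : ℝ)) (μ := volume) (hE.const_mul ((L : ℝ) - 2))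
    (integrable_finsetSum _ fun l _ => hint (Finset.univ.filter fun i => f i ≠ l)) hpt
  rw [integral_finsetSum _ fun l _ => hint _, integral_const_mul] at h1
  have : Nonempty (Fin L) := ⟨⟨0, hL⟩⟩
  have h2 := Finset.sum_lt_sum_of_nonempty (Finset.univ_nonempty (α := Fin L)) fun l _ => hcon l
  simp only [Finset.sum_const, Finset.card_univ, Fintype.card_fin, nsmul_eq_mul] at h2
  have hL' : (0 : ℝ) < L := by exact_mod_cast hL
  have : (L : ℝ) * ((1 - 2 / L) * ∫ t in Set.Ioi 0, twoReach E Finset.univ t)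
      = (L - 2) * ∫ t in Set.Ioi 0, twoReach E Finset.univ t := by
    field_simp
  linarith

/-! ### Consequences of optimality, and comparison of economies by ranges of values -/

/-- Markov's inequality for the revenue of `n` copies of one distribution: since the second-highest
value reaches `τ R` with probability at most `1 / τ`, the distribution itself reaches it with
probability `O(1 / (n √τ))`. -/
theorem mul_survival_sq_le {n : ℕ} (hn : 24 ≤ n) (F : ProbabilityMeasure ℝ≥0)
    (hF : IntegrableOn (twoReach (fun _ : Fin n => F) Finset.univ) (Set.Ioi 0)) {R τ : ℝ}
    (hR : 0 < R) (hτ : 12 < τ)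
    (hFR : ∫ t in Set.Ioi 0, twoReach (fun _ : Fin n => F) Finset.univ t ≤ R)
    {t : ℝ} (ht : τ * R ≤ t) : (n * survival F t) ^ 2 ≤ 12 / τ := by
  set P := twoReach (fun _ : Fin n => F) Finset.univ with hP
  have hT : 0 < τ * R := by positivity
  have h1 : τ * R * P (τ * R) ≤ R := by
    calc τ * R * P (τ * R) = ∫ _ in Set.Ioc 0 (τ * R), P (τ * R) := by
          rw [setIntegral_const]
          simp [hT.le]
      _ ≤ ∫ t in Set.Ioc 0 (τ * R), P t :=
          setIntegral_mono_on (integrableOn_const (by simp)) (hF.mono_set Set.Ioc_subset_Ioi_self)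
            measurableSet_Ioc fun s hs => twoReach_antitone _ _ hs.2
      _ ≤ ∫ t in Set.Ioi 0, P t := setIntegral_mono_set hF
            (Filter.Eventually.of_forall fun s => twoReach_nonneg _ _ _)
            (Set.Ioc_subset_Ioi_self).eventuallyLE
      _ ≤ R := hFR
  have h2 : P (τ * R) ≤ 1 / τ := by
    rw [le_div_iff₀ (by linarith)]
    nlinarith
  have h3 := min_sq_le_twoReach hn F (τ * R)
  have h4 : min 1 ((n * survival F (τ * R)) ^ 2) ≤ 12 / τ := by
    have : 12 / τ = 12 * (1 / τ) := by ring
    rw [this]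
    linarith
  have h5 : 12 / τ < 1 := by rw [div_lt_one (by linarith)]; exact hτ
  have h6 : (n * survival F (τ * R)) ^ 2 ≤ 12 / τ := by
    rcases min_le_iff.1 h4 with h | h
    · linarith
    · exact h
  refine le_trans ?_ h6
  have := survival_antitone F ht
  have := survival_nonneg F t
  gcongr

/-- Where `n q_F ≤ 1`, the `n` copies of `F` give a revenue of order `∫ (n q_F)²`. -/
theorem memLp_survival {n : ℕ} (hn : 24 ≤ n) (F : ProbabilityMeasure ℝ≥0)
    (hF : IntegrableOn (twoReach (fun _ : Fin n => F) Finset.univ) (Set.Ioi 0)) {R T : ℝ}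
    (hT : 0 ≤ T) (hFR : ∫ t in Set.Ioi 0, twoReach (fun _ : Fin n => F) Finset.univ t ≤ R)
    (h1 : ∀ t, T ≤ t → (n * survival F t) ^ 2 ≤ 1) :
    MemLp (survival F) 2 (volume.restrict (Set.Ioi T)) ∧
      ∫ t in Set.Ioi T, survival F t ^ 2 ≤ 12 * R / n ^ 2 := by
  set P := twoReach (fun _ : Fin n => F) Finset.univ with hP
  have hn0 : (0 : ℝ) < n := by exact_mod_cast (by omega : 0 < n)
  have hmeas : Measurable (survival F) := (survival_antitone F).measurable
  have hle : ∀ t ∈ Set.Ioi T, survival F t ^ 2 ≤ 12 / n ^ 2 * P t := by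
    intro t ht
    have h3 := min_sq_le_twoReach hn F t
    rw [min_eq_right (h1 t (le_of_lt ht))] at h3
    rw [div_mul_eq_mul_div, le_div_iff₀ (by positivity)]
    linarith [mul_pow (n : ℝ) (survival F t) 2]
  have hPT : IntegrableOn P (Set.Ioi T) := hF.mono_set (Set.Ioi_subset_Ioi hT)
  have hint : IntegrableOn (fun t => survival F t ^ 2) (Set.Ioi T) := by
    refine Integrable.mono' (hPT.const_mul (12 / (n : ℝ) ^ 2))
      (hmeas.pow_const 2).aestronglyMeasurable ?_
    filter_upwards [self_mem_ae_restrict measurableSet_Ioi] with t ht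
    rw [Real.norm_of_nonneg (sq_nonneg _)]
    exact hle t ht
  refine ⟨(memLp_two_iff_integrable_sq hmeas.aestronglyMeasurable).2 hint, ?_⟩
  calc ∫ t in Set.Ioi T, survival F t ^ 2 ≤ ∫ t in Set.Ioi T, 12 / (n : ℝ) ^ 2 * P t :=
        setIntegral_mono_on hint (hPT.const_mul _) measurableSet_Ioi hle
    _ = 12 / (n : ℝ) ^ 2 * ∫ t in Set.Ioi T, P t := integral_const_mul _ _
    _ ≤ 12 / (n : ℝ) ^ 2 * R := by
        gcongr
        exact (setIntegral_mono_set hF (Filter.Eventually.of_forall fun s => twoReach_nonneg _ _ _)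
          (Set.Ioi_subset_Ioi hT).eventuallyLE).trans hFR
    _ = _ := by ring

/-- Comparison of two economies at high values, where the revenue is essentially
half the squared `L²` norm of the expected number of bidders reaching `t`. -/
theorem integral_twoReach_tail_le {n : ℕ} (hn : 0 < n) (E E' : Economy n) (S : Finset (Fin n))
    {R T η : ℝ} (hη : η ≤ 1)
    (hint : IntegrableOn (twoReach E S) (Set.Ioi T))
    (hint' : IntegrableOn (twoReach E' S) (Set.Ioi T))
    (hL : ∀ i, MemLp (survival (E i)) 2 (volume.restrict (Set.Ioi T)))
    (hL' : ∀ i, MemLp (survival (E' i)) 2 (volume.restrict (Set.Ioi T)))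
    (hR : ∀ i, ∫ t in Set.Ioi T, survival (E i) t ^ 2 ≤ 12 * R / n ^ 2)
    (hR' : ∀ i, ∫ t in Set.Ioi T, survival (E' i) t ^ 2 ≤ 12 * R / n ^ 2)
    (hQ' : ∀ t, T < t → ∑ i ∈ S, survival (E' i) t ≤ η)
    (hprod : ∀ i ∈ S, ∫ t in Set.Ioi T, (∑ j ∈ S, survival (E j) t) * survival (E i) t
      ≤ ∫ t in Set.Ioi T, (∑ j ∈ S, survival (E j) t) * survival (E' i) t) :
    ∫ t in Set.Ioi T, twoReach E S t
      ≤ (∫ t in Set.Ioi T, twoReach E' S t) + 36 * R / n + 6 * η * R := by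
  have hn0 : (0 : ℝ) < n := by exact_mod_cast hn
  set Q : ℝ → ℝ := fun t => ∑ i ∈ S, survival (E i) t with hQdef
  set Q' : ℝ → ℝ := fun t => ∑ i ∈ S, survival (E' i) t with hQ'def
  have hQ0 : ∀ t, 0 ≤ Q t := fun t => Finset.sum_nonneg fun i _ => survival_nonneg _ _
  have hQ'0 : ∀ t, 0 ≤ Q' t := fun t => Finset.sum_nonneg fun i _ => survival_nonneg _ _
  have hη0 : 0 ≤ η := (hQ'0 (T + 1)).trans (hQ' _ (by linarith))
  have hQL : MemLp Q 2 (volume.restrict (Set.Ioi T)) := memLp_finsetSum S fun i _ => hL i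
  have hQL' : MemLp Q' 2 (volume.restrict (Set.Ioi T)) := memLp_finsetSum S fun i _ => hL' i
  have iQQ : IntegrableOn (fun t => Q t ^ 2) (Set.Ioi T) := hQL.integrable_sq
  have iQQ' : IntegrableOn (fun t => Q t * Q' t) (Set.Ioi T) := hQL.integrable_mul hQL'
  have iq : ∀ i, IntegrableOn (fun t => survival (E i) t ^ 2) (Set.Ioi T) :=
    fun i => (hL i).integrable_sq
  have iq' : ∀ i, IntegrableOn (fun t => survival (E' i) t ^ 2) (Set.Ioi T) :=
    fun i => (hL' i).integrable_sq
  have isum : IntegrableOn (fun t => ∑ i ∈ S, survival (E i) t ^ 2) (Set.Ioi T) :=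
    integrable_finsetSum S fun i _ => iq i
  have isum' : IntegrableOn (fun t => ∑ i ∈ S, survival (E' i) t ^ 2) (Set.Ioi T) :=
    integrable_finsetSum S fun i _ => iq' i
  have hR0 : 0 ≤ 12 * R / n ^ 2 :=
    (integral_nonneg fun t => sq_nonneg _).trans (hR ⟨0, hn⟩)
  have hcard : (S.card : ℝ) ≤ n := by
    exact_mod_cast (Finset.card_le_univ S).trans_eq (Fintype.card_fin n)
  have hsumle : ∑ i ∈ S, 12 * R / (n : ℝ) ^ 2 ≤ 12 * R / n := by
    rw [Finset.sum_const, nsmul_eq_mul]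
    calc (S.card : ℝ) * (12 * R / n ^ 2) ≤ n * (12 * R / n ^ 2) := by gcongr
      _ = _ := by field_simp
  have hs : ∫ t in Set.Ioi T, ∑ i ∈ S, survival (E i) t ^ 2 ≤ 12 * R / n := by
    rw [integral_finsetSum S fun i _ => iq i]
    exact (Finset.sum_le_sum fun i _ => hR i).trans hsumle
  have hs' : ∫ t in Set.Ioi T, ∑ i ∈ S, survival (E' i) t ^ 2 ≤ 12 * R / n := by
    rw [integral_finsetSum S fun i _ => iq' i]
    exact (Finset.sum_le_sum fun i _ => hR' i).trans hsumle
  set A := ∫ t in Set.Ioi T, Q t ^ 2 with hA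
  have hA12 : A ≤ 12 * R := by
    calc A ≤ ∫ t in Set.Ioi T, n * ∑ i ∈ S, survival (E i) t ^ 2 := by
          refine integral_mono iQQ (isum.const_mul _) fun t => ?_
          refine (sq_sum_le_card_mul_sum_sq (s := S)).trans ?_
          gcongr
      _ = n * ∫ t in Set.Ioi T, ∑ i ∈ S, survival (E i) t ^ 2 := integral_const_mul _ _
      _ ≤ n * (12 * R / n) := by gcongr
      _ = _ := by field_simp
  have hcross : A ≤ ∫ t in Set.Ioi T, Q t * Q' t := by
    have e1 : A = ∑ i ∈ S, ∫ t in Set.Ioi T, Q t * survival (E i) t := by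
      have i1 : ∀ i ∈ S, IntegrableOn (fun t => Q t * survival (E i) t) (Set.Ioi T) :=
        fun i _ => hQL.integrable_mul (hL i)
      rw [← integral_finsetSum S i1]
      exact integral_congr_ae (Filter.Eventually.of_forall fun t => by
        simp only [← Finset.mul_sum]
        exact sq (Q t))
    have e2 : ∫ t in Set.Ioi T, Q t * Q' t
        = ∑ i ∈ S, ∫ t in Set.Ioi T, Q t * survival (E' i) t := by
      have i1 : ∀ i ∈ S, IntegrableOn (fun t => Q t * survival (E' i) t) (Set.Ioi T) :=
        fun i _ => hQL.integrable_mul (hL' i)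
      rw [← integral_finsetSum S i1]
      exact integral_congr_ae (Filter.Eventually.of_forall fun t => by
        simp only [← Finset.mul_sum, hQ'def])
    rw [e1, e2]
    exact Finset.sum_le_sum hprod
  have hup : ∫ t in Set.Ioi T, twoReach E S t ≤ 1 / 2 * A + 12 * R / n := by
    calc ∫ t in Set.Ioi T, twoReach E S t
        ≤ ∫ t in Set.Ioi T, (1 / 2 * Q t ^ 2 + ∑ i ∈ S, survival (E i) t ^ 2) := by
          refine integral_mono hint ((iQQ.const_mul _).add isum) fun t => ?_
          have h1 := twoReach_le_poissonTwo_add E S t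
          have h2 := poissonTwo_le_sq (hQ0 t)
          simp only [hQdef] at h2 ⊢
          linarith
      _ = 1 / 2 * A + ∫ t in Set.Ioi T, ∑ i ∈ S, survival (E i) t ^ 2 := by
          rw [integral_add (iQQ.const_mul _) isum, integral_const_mul]
      _ ≤ _ := by linarith
  have hlow : (1 - η) / 2 * (2 * (∫ t in Set.Ioi T, Q t * Q' t) - A)
      ≤ (∫ t in Set.Ioi T, twoReach E' S t) + 2 * (12 * R / n) := by
    calc (1 - η) / 2 * (2 * (∫ t in Set.Ioi T, Q t * Q' t) - A)
        = ∫ t in Set.Ioi T, (1 - η) / 2 * (2 * (Q t * Q' t) - Q t ^ 2) := by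
          rw [integral_const_mul, integral_sub (iQQ'.const_mul 2) iQQ, integral_const_mul]
      _ ≤ ∫ t in Set.Ioi T, (twoReach E' S t + 2 * ∑ i ∈ S, survival (E' i) t ^ 2) := by
          refine setIntegral_mono_on (((iQQ'.const_mul 2).sub iQQ).const_mul _)
            (hint'.add (isum'.const_mul 2)) measurableSet_Ioi fun t ht => ?_
          have h1 := poissonTwo_sub_le_twoReach E' S t
          have h2 := sq_le_poissonTwo (hQ'0 t)
          have h3 : Q' t ≤ η := hQ' t ht
          have h4 : Q' t ^ 3 ≤ η * Q' t ^ 2 := by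
            rw [pow_succ, mul_comm]
            gcongr
          have h6 : 0 ≤ η * Q' t ^ 2 := by positivity
          have h5 : (1 - η) / 2 * (2 * (Q t * Q' t) - Q t ^ 2) ≤ (1 - η) / 2 * Q' t ^ 2 := by
            have : 0 ≤ (1 - η) / 2 := by linarith
            gcongr
            -- The tangent to the convex function `Q' ^ 2` at `Q`.
            nlinarith [sq_nonneg (Q t - Q' t)]
          simp only [hQ'def] at h2 h4 h5 h6 ⊢
          linarith
      _ = (∫ t in Set.Ioi T, twoReach E' S t)
            + 2 * ∫ t in Set.Ioi T, ∑ i ∈ S, survival (E' i) t ^ 2 := by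
          rw [integral_add hint' (isum'.const_mul 2), integral_const_mul]
      _ ≤ _ := by linarith
  have h7 : (1 - η) / 2 * A ≤ (1 - η) / 2 * (2 * (∫ t in Set.Ioi T, Q t * Q' t) - A) := by
    have : 0 ≤ (1 - η) / 2 := by linarith
    gcongr
    linarith
  have h8 : η * A ≤ η * (12 * R) := by gcongr
  have h9 : 36 * R / n = 3 * (12 * R / n) := by ring
  rw [h9]
  linarith

/-- Two antitone functions, the first one bounded by one, that are compared at the points of an
arithmetic grid only: the grid costs a shift by its step `h`. -/
theorem integral_Ioc_le_of_grid {p p' : ℝ → ℝ} (hp : Antitone p) (hp' : Antitone p')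
    (hp0 : ∀ t, 0 ≤ p t) (hp1 : ∀ t, p t ≤ 1) {h e : ℝ} (hh : 0 < h) {K : ℕ}
    (hgrid : ∀ j < K, p ((j + 1 : ℝ) * h) ≤ p' ((j + 1 : ℝ) * h) + e) :
    ∫ t in Set.Ioc 0 (K * h), p t ≤ (∫ t in Set.Ioc 0 (K * h), p' t) + h + e * (K * h) := by
  set T : ℝ := K * h with hTdef
  have hT : 0 ≤ T := by positivity
  have hle : ∀ t, 0 < t → t ≤ T → p (t + h) ≤ p' t + e := by
    intro t ht0 htT
    have hc0 : 0 < ⌈t / h⌉₊ := Nat.ceil_pos.2 (by positivity)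
    obtain ⟨j, hj⟩ : ∃ j, ⌈t / h⌉₊ = j + 1 := ⟨⌈t / h⌉₊ - 1, by omega⟩
    have h1 : t ≤ (j + 1 : ℝ) * h := by
      have := Nat.le_ceil (t / h)
      rw [hj, div_le_iff₀ hh] at this
      exact_mod_cast this
    have h2 : (j + 1 : ℝ) * h ≤ t + h := by
      have := Nat.ceil_lt_add_one (a := t / h) (by positivity)
      rw [hj] at this
      push_cast at this
      have h3 : (j : ℝ) < t / h := by linarith
      rw [lt_div_iff₀ hh] at h3
      linarith
    have h3 : j < K := by
      have : ⌈t / h⌉₊ ≤ K := Nat.ceil_le.2 ((div_le_iff₀ hh).2 htT)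
      omega
    have := hgrid j h3
    have := hp h2
    have := hp' h1
    linarith
  have ip : ∀ a b : ℝ, IntervalIntegrable p volume a b := fun a b => hp.intervalIntegrable
  rw [← intervalIntegral.integral_of_le hT, ← intervalIntegral.integral_of_le hT]
  have h1 : ∫ t in (0 : ℝ)..T, p (t + h) ≤ ∫ t in (0 : ℝ)..T, (p' t + e) := by
    refine intervalIntegral.integral_mono_on_of_le_Ioo hT ?_
      (hp'.intervalIntegrable.add intervalIntegrable_const) fun t ht => hle t ht.1 ht.2.le
    exact Antitone.intervalIntegrable fun a b hab => hp (by linarith)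
  rw [intervalIntegral.integral_comp_add_right (fun t => p t), zero_add,
    intervalIntegral.integral_add hp'.intervalIntegrable intervalIntegrable_const,
    intervalIntegral.integral_const, smul_eq_mul] at h1
  have h2 : ∫ t in (0 : ℝ)..h, p t ≤ h := by
    have := intervalIntegral.integral_mono_on hh.le (ip 0 h) intervalIntegrable_const
      fun t _ => hp1 t
    simpa using this
  have h3 : 0 ≤ ∫ t in T..(T + h), p t :=
    intervalIntegral.integral_nonneg (by linarith) fun t _ => hp0 t
  have h4 := intervalIntegral.integral_add_adjacent_intervals (ip 0 h) (ip h (T + h))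
  have h5 := intervalIntegral.integral_add_adjacent_intervals (ip 0 T) (ip T (T + h))
  linarith

/-! ### The approximating economy for many bidders and finite revenue -/

/-- A choice of one representative in each class of `c` that maximizes `v` in its class. -/
theorem exists_representative {α β : Type*} [DecidableEq α] [Fintype β] [DecidableEq β]
    (D : Finset α) (c : α → β) (v : α → ℝ) :
    ∃ r : α → α, (∀ x ∈ D, r x ∈ D ∧ c (r x) = c x ∧ v x ≤ v (r x)) ∧
      (D.image r).card ≤ Fintype.card β := by
  rcases D.eq_empty_or_nonempty with rfl | ⟨x₀, -⟩
  · exact ⟨id, by simp⟩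
  have h : ∀ b : β, ∃ y, ∀ x ∈ D, c x = b → y ∈ D ∧ c y = b ∧ v x ≤ v y := by
    intro b
    rcases (D.filter fun x => c x = b).eq_empty_or_nonempty with he | hne
    · exact ⟨x₀, fun x hx hb => absurd (Finset.mem_filter.2 ⟨hx, hb⟩) (he ▸ Finset.notMem_empty x)⟩
    · obtain ⟨y, hy, hmax⟩ := Finset.exists_max_image _ v hne
      obtain ⟨hyD, hyb⟩ := Finset.mem_filter.1 hy
      exact ⟨y, fun x hx hb => ⟨hyD, hyb, hmax x (Finset.mem_filter.2 ⟨hx, hb⟩)⟩⟩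
  choose s hs using h
  refine ⟨fun x => s (c x), fun x hx => hs (c x) x hx rfl, ?_⟩
  have : D.image (fun x => s (c x)) ⊆ Finset.univ.image s := fun y hy => by
    obtain ⟨x, -, rfl⟩ := Finset.mem_image.1 hy
    exact Finset.mem_image_of_mem s (Finset.mem_univ _)
  exact (Finset.card_le_card this).trans Finset.card_image_le

theorem div_le_card_mod_eq (n : ℕ) {L : ℕ} (hL : 0 < L) (l : Fin L) :
    n / L ≤ (Finset.univ.filter fun i : Fin n => i.1 % L = l.1).card := by
  have hlt : ∀ j : Fin (n / L), j.1 * L + l.1 < n := fun j => by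
    have h1 : (j.1 + 1) * L ≤ n / L * L := Nat.mul_le_mul_right _ j.2
    have h2 := Nat.div_mul_le_self n L
    have := l.2
    nlinarith
  have := Finset.card_le_card_of_injOn (s := (Finset.univ : Finset (Fin (n / L))))
    (t := Finset.univ.filter fun i : Fin n => i.1 % L = l.1)
    (fun j => (⟨j.1 * L + l.1, hlt j⟩ : Fin n))
    (fun j _ => by simp [Nat.mod_eq_of_lt l.2])
    (fun i _ j _ hij => by
      simp only [Fin.mk.injEq, Nat.add_right_cancel_iff] at hij
      exact Fin.ext (Nat.eq_of_mul_eq_mul_right hL hij))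
  simpa using this

/-- If the survival functions at `t` are small and one economy nearly dominates the other in
them, then so it does in the probability that two bidders reach `t`. -/
theorem twoReach_le_of_survival_le {n : ℕ} (E E' : Economy n) (S : Finset (Fin n)) (t : ℝ)
    {p δ : ℝ} (hδ : 0 ≤ δ) (hp : ∀ i ∈ S, survival (E i) t ≤ p)
    (hp' : ∀ i ∈ S, survival (E' i) t ≤ p)
    (hle : ∀ i ∈ S, survival (E i) t ≤ survival (E' i) t + δ / n) :
    twoReach E S t ≤ twoReach E' S t + δ + 3 * (n * p ^ 2) := by
  have hcard : (S.card : ℝ) ≤ n := by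
    exact_mod_cast (Finset.card_le_univ S).trans_eq (Fintype.card_fin n)
  have hsq : ∀ F : Economy n, (∀ i ∈ S, survival (F i) t ≤ p) →
      ∑ i ∈ S, survival (F i) t ^ 2 ≤ n * p ^ 2 := by
    intro F hF
    calc ∑ i ∈ S, survival (F i) t ^ 2 ≤ ∑ i ∈ S, p ^ 2 := Finset.sum_le_sum fun i hi =>
          pow_le_pow_left₀ (survival_nonneg _ _) (hF i hi) 2
      _ = S.card * p ^ 2 := by simp
      _ ≤ n * p ^ 2 := by gcongr
  have h1 := twoReach_le_poissonTwo_add E S t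
  have h2 := poissonTwo_sub_le_twoReach E' S t
  have h3 := hsq E hp
  have h4 := hsq E' hp'
  have hQ0 : 0 ≤ ∑ i ∈ S, survival (E i) t := Finset.sum_nonneg fun i _ => survival_nonneg _ _
  have hQ0' : 0 ≤ ∑ i ∈ S, survival (E' i) t := Finset.sum_nonneg fun i _ => survival_nonneg _ _
  have h5 : ∑ i ∈ S, survival (E i) t ≤ ∑ i ∈ S, survival (E' i) t + δ := by
    refine (Finset.sum_le_sum hle).trans ?_
    rw [Finset.sum_add_distrib, Finset.sum_const, nsmul_eq_mul]
    have : (S.card : ℝ) * (δ / n) ≤ δ := by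
      rw [mul_div_left_comm]
      exact mul_le_of_le_one_right hδ (div_le_one_of_le₀ hcard (by positivity))
    linarith
  have h6 := poissonTwo_mono hQ0 h5
  have h7 := poissonTwo_le_add hQ0' (le_add_of_nonneg_right hδ)
  linarith

/-- If the floors of `x` and `y`, capped at `N`, agree and `x` is below the cap, then `y` cannot be
below `x - 1`. -/
theorem le_add_one_of_floor_min_eq {x y : ℝ} (hy0 : 0 ≤ y) {N : ℕ} (hx : x < N)
    (h : min ⌊y⌋₊ N = min ⌊x⌋₊ N) : x ≤ y + 1 := by
  have h1 : ⌊x⌋₊ < N ∨ N = 0 := by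
    rcases Nat.eq_zero_or_pos N with h0 | h0
    · exact Or.inr h0
    · exact Or.inl ((Nat.floor_lt' h0.ne').2 hx)
  rcases h1 with h1 | h1
  · have h2 : ⌊x⌋₊ ≤ ⌊y⌋₊ := by omega
    have h3 : (⌊x⌋₊ : ℝ) ≤ ⌊y⌋₊ := by exact_mod_cast h2
    linarith [Nat.lt_floor_add_one x, Nat.floor_le hy0]
  · subst h1
    push_cast at hx
    linarith

/-- One element `a` of `D` reaches the level `c` at all grid points `j < K` at which some element
does: the one that reaches it at the last of these points. -/
theorem exists_saturating {α : Type*} {D : Finset α} (hD : D.Nonempty) (q : α → ℕ → ℝ)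
    (hq : ∀ a, Antitone (q a)) (K : ℕ) (c : ℝ) :
    ∃ a ∈ D, ∀ j < K, (∃ a' ∈ D, c ≤ q a' j) → c ≤ q a j := by
  classical
  rcases ((Finset.range K).filter fun j => ∃ a' ∈ D, c ≤ q a' j).eq_empty_or_nonempty with he | hne
  · obtain ⟨a, ha⟩ := hD
    exact ⟨a, ha, fun j hj h =>
      absurd h (Finset.filter_eq_empty_iff.1 he (Finset.mem_range.2 hj))⟩
  · obtain ⟨j₀, hj₀, hmax⟩ := Finset.exists_max_image _ (fun j : ℕ => j) hne
    obtain ⟨-, a, ha, hca⟩ := Finset.mem_filter.1 hj₀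
    refine ⟨a, ha, fun j hj h => hca.trans (hq a ?_)⟩
    exact hmax j (Finset.mem_filter.2 ⟨Finset.mem_range.2 hj, h⟩)

theorem card_classes_le {k : ℕ} (hk : 30 ≤ k) : (2 * k ^ 15 + 1) ^ k ^ 6 + 1 ≤ k ^ k ^ 7 := by
  have hk0 : 0 < k := by omega
  have h2 : 2 * k ^ 15 + 2 ≤ k ^ 16 := by
    have : 0 < k ^ 15 := by positivity
    nlinarith [pow_succ k 15]
  have h3 : 16 * k ^ 6 ≤ k ^ 7 := by
    rw [pow_succ k 6, mul_comm]
    exact Nat.mul_le_mul_left _ (by omega)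
  calc (2 * k ^ 15 + 1) ^ k ^ 6 + 1 ≤ (2 * k ^ 15 + 2) ^ k ^ 6 :=
        Nat.pow_lt_pow_left (by omega) (by positivity)
    _ ≤ (k ^ 16) ^ k ^ 6 := Nat.pow_le_pow_left h2 _
    _ = k ^ (16 * k ^ 6) := by rw [← pow_mul]
    _ ≤ k ^ k ^ 7 := Nat.pow_le_pow_right hk0 h3

/-- The errors of all approximation steps add up to at most `R / k`. Here `a`, `a'` are the
revenues from low values and `c`, `c'` those from high values. -/
theorem le_of_error_le {n k : ℕ} {R a a' c c' : ℝ} (hkr : (30 : ℝ) ≤ k)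
    (hknr : (k : ℝ) ^ 25 ≤ n) (hR : 0 < R)
    (hl : (1 - 2 / ((k ^ 2 : ℕ) : ℝ)) * R ≤ a + c)
    (htail : c ≤ c' + 36 * R / n + 6 * (4 / k ^ 2) * R)
    (hlow : a ≤ a' + R / k ^ 2 + 2 / k ^ 6 * (k ^ 4 * R)) :
    (1 - 1 / (k : ℝ)) * R ≤ a' + c' := by
  have hkr0 : (0 : ℝ) < k := by linarith
  have hn0 : (0 : ℝ) < n := lt_of_lt_of_le (by positivity) hknr
  have e1 : 36 * R / n ≤ R * (1 / k ^ 2) := by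
    rw [mul_one_div, div_le_div_iff₀ hn0 (by positivity)]
    have h1 : (k : ℝ) ^ 4 ≤ n := (pow_le_pow_right₀ (by linarith) (by norm_num)).trans hknr
    have h2 : 36 * (k : ℝ) ^ 2 ≤ k ^ 4 := by nlinarith [pow_pos hkr0 2, pow_pos hkr0 3]
    nlinarith
  have e2 : 2 / (k : ℝ) ^ 6 * (k ^ 4 * R) = R * (2 * (1 / k ^ 2)) := by
    field_simp
  have e3 : R / (k : ℝ) ^ 2 = R * (1 / k ^ 2) := by ring
  have e4 : 6 * (4 / (k : ℝ) ^ 2) * R = R * (24 * (1 / k ^ 2)) := by ring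
  have e5 : (1 - 2 / ((k ^ 2 : ℕ) : ℝ)) * R = R - R * (2 * (1 / k ^ 2)) := by
    push_cast
    ring
  have e6 : R * (30 * (1 / (k : ℝ) ^ 2)) ≤ R * (1 / k) := by
    gcongr
    rw [mul_one_div, div_le_div_iff₀ (by positivity) hkr0]
    nlinarith
  rw [e5] at hl
  linarith

/-- The case of many bidders and finite revenues. The numerical choices are a block of about
`n / k ^ 2` bidders for `G`, a grid of `k ^ 6` points of step `R / k ^ 2`, the saturation level
`k ^ 7`, and classes given by `n q_F` in multiples of `1 / k ^ 6`, capped at `2 k ^ 9` (a bound for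
`n q_F` at unsaturated points). -/
theorem exists_small_of_integrable {n k : ℕ} (hk : 30 ≤ k) (hkn : k ^ 25 ≤ n)
    {D : Finset (ProbabilityMeasure ℝ≥0)} (hD : D.Nonempty) {R : ℝ} (hR : 0 < R)
    (hint : ∀ E : Economy n, (∀ i, E i ∈ D) → IntegrableOn (twoReach E Finset.univ) (Set.Ioi 0))
    (hle : ∀ E : Economy n, (∀ i, E i ∈ D) → ∫ t in Set.Ioi 0, twoReach E Finset.univ t ≤ R)
    (E : Economy n) (hE : ∀ i, E i ∈ D)
    (hER : ∫ t in Set.Ioi 0, twoReach E Finset.univ t = R) :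
    ∃ D' ⊆ D, D'.card ≤ k ^ k ^ 7 ∧ ∃ E' : Economy n, (∀ i, E' i ∈ D') ∧
      (1 - 1 / (k : ℝ)) * R ≤ ∫ t in Set.Ioi 0, twoReach E' Finset.univ t := by
  classical
  have hk0 : 0 < k := by omega
  have hkr : (30 : ℝ) ≤ k := by exact_mod_cast hk
  have hkr0 : (0 : ℝ) < k := by linarith
  have hknr : (k : ℝ) ^ 25 ≤ n := by exact_mod_cast hkn
  have hk2n : (k : ℝ) ^ 2 ≤ n := (pow_le_pow_right₀ (by linarith) (by norm_num)).trans hknr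
  have hn0 : (0 : ℝ) < n := by
    have : (0 : ℝ) < (k : ℝ) ^ 25 := by positivity
    linarith
  have hn24 : 24 ≤ n := by
    have : (24 : ℝ) ≤ n := by nlinarith
    exact_mod_cast this
  set h : ℝ := R / k ^ 2 with hh
  set T : ℝ := k ^ 4 * R with hT
  have hh0 : 0 < h := by positivity
  have hT0 : 0 < T := by positivity
  have hTh : T = (k ^ 6 : ℕ) * h := by
    rw [hT, hh]
    push_cast
    field_simp
  -- The bidders outside `S` form the block that is replaced by copies of one distribution.
  obtain ⟨l, hl⟩ := exists_block_integral_le E (hint E hE) (L := k ^ 2) (by positivity)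
    fun i => ⟨i.1 % k ^ 2, Nat.mod_lt _ (by positivity)⟩
  set S : Finset (Fin n) := Finset.univ.filter fun i : Fin n =>
    (⟨i.1 % k ^ 2, Nat.mod_lt _ (by positivity)⟩ : Fin (k ^ 2)) ≠ l with hS
  have hm : (n : ℝ) ≤ 2 * k ^ 2 * (Sᶜ.card : ℝ) := by
    have h1 : Sᶜ = Finset.univ.filter fun i : Fin n => i.1 % k ^ 2 = l.1 := by
      ext i
      simp [hS, Fin.ext_iff]
    have h2 := div_le_card_mod_eq n (L := k ^ 2) (by positivity) l
    rw [← h1] at h2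
    have h3 := Nat.lt_div_mul_add (a := n) (b := k ^ 2) (by positivity)
    have h4 : 1 ≤ n / k ^ 2 := Nat.div_pos (by exact_mod_cast hk2n) (by positivity)
    have h5 : n ≤ 2 * k ^ 2 * Sᶜ.card := by nlinarith [Nat.pow_pos (n := 2) hk0]
    exact_mod_cast h5
  set m : ℝ := (Sᶜ.card : ℝ) with hmdef
  have hm0 : 0 < m := by
    by_contra! hcon
    have : 2 * (k : ℝ) ^ 2 * m ≤ 0 := mul_nonpos_of_nonneg_of_nonpos (by positivity) hcon
    linarith
  have hpm : ∀ x, m * x < k ^ 7 → x < 2 * k ^ 9 / n := fun x hx => by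
    rw [lt_div_iff₀ hn0]
    rcases le_or_gt x 0 with hx0 | hx0
    · have : 0 < 2 * (k : ℝ) ^ 9 := by positivity
      nlinarith
    · calc x * n ≤ x * (2 * k ^ 2 * m) := by gcongr
        _ = 2 * k ^ 2 * (m * x) := by ring
        _ < 2 * k ^ 2 * k ^ 7 := by gcongr
        _ = _ := by ring
  -- `G` saturates the replaced block at every grid point where some distribution of `D` does.
  obtain ⟨G, hG, hGsat⟩ := exists_saturating hD (fun F j => m * survival F ((j + 1 : ℝ) * h))
    (fun F i j hij => by
      have : survival F ((j + 1 : ℝ) * h) ≤ survival F ((i + 1 : ℝ) * h) :=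
        survival_antitone F (by gcongr)
      dsimp only
      gcongr) (k ^ 6) ((k : ℝ) ^ 7)
  -- `v` is the functional to be kept from decreasing for high values.
  set v : ProbabilityMeasure ℝ≥0 → ℝ := fun F =>
    ∫ t in Set.Ioi T, (∑ j ∈ S, survival (E j) t) * survival F t with hv
  obtain ⟨r, hr, hrcard⟩ := exists_representative D
    (fun F (j : Fin (k ^ 6)) => (⟨min ⌊n * survival F ((j.1 + 1 : ℝ) * h) * k ^ 6⌋₊ (2 * k ^ 15),
      Nat.lt_succ_of_le (min_le_right _ _)⟩ : Fin (2 * k ^ 15 + 1))) v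
  set E' : Economy n := fun i => if i ∈ S then r (E i) else G with hE'
  have hE'D : ∀ i, E' i ∈ D := fun i => by
    by_cases hi : i ∈ S
    · simpa [hE', hi] using (hr _ (hE i)).1
    · simpa [hE', hi] using hG
  refine ⟨insert G (D.image r), ?_, ?_, E', ?_, ?_⟩
  · refine Finset.insert_subset hG fun F hF => ?_
    obtain ⟨F', hF', rfl⟩ := Finset.mem_image.1 hF
    exact (hr F' hF').1
  · refine (Finset.card_insert_le _ _).trans ?_
    rw [Fintype.card_fun, Fintype.card_fin, Fintype.card_fin] at hrcard
    exact (Nat.add_le_add_right hrcard 1).trans (card_classes_le hk)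
  · intro i
    by_cases hi : i ∈ S
    · simpa [hE', hi] using Or.inr ⟨E i, hE i, rfl⟩
    · simp [hE', hi]
  have hE'S : ∀ i ∈ S, E' i = r (E i) := fun i hi => if_pos hi
  have hcopy := fun F (hF : F ∈ D) => hint (fun _ => F) fun _ => hF
  have hcopyle := fun F (hF : F ∈ D) => hle (fun _ => F) fun _ => hF
  have hsmall : ∀ F ∈ D, ∀ t, T ≤ t → n * survival F t ≤ 4 / k ^ 2 := by
    intro F hF t ht
    have h1 := mul_survival_sq_le hn24 F (hcopy F hF) hR (τ := (k : ℝ) ^ 4)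
      (by nlinarith [pow_pos hkr0 3, pow_pos hkr0 2]) (hcopyle F hF) ht
    refine abs_le_of_sq_le_sq' ?_ (by positivity) |>.2
    refine h1.trans ?_
    rw [div_pow, ← pow_mul]
    gcongr
    norm_num
  have hLp := fun F (hF : F ∈ D) => memLp_survival hn24 F (hcopy F hF) hT0.le (hcopyle F hF)
    fun t ht => by
      have h1 := hsmall F hF t ht
      have h2 : 4 / (k : ℝ) ^ 2 ≤ 1 := by
        rw [div_le_one (by positivity)]
        nlinarith
      exact pow_le_one₀ (mul_nonneg hn0.le (survival_nonneg _ _)) (h1.trans h2)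
  have hI := integrableOn_twoReach (hint E hE) S
  have hI' := integrableOn_twoReach (hint E' hE'D) Finset.univ
  have hI'S := integrableOn_twoReach (hint E' hE'D) S
  have hIoi : Set.Ioi T ⊆ Set.Ioi 0 := Set.Ioi_subset_Ioi hT0.le
  -- Values above `T`.
  have htail : ∫ t in Set.Ioi T, twoReach E S t
      ≤ (∫ t in Set.Ioi T, twoReach E' Finset.univ t) + 36 * R / n + 6 * (4 / k ^ 2) * R := by
    refine (integral_twoReach_tail_le (by omega) E E' S (η := 4 / (k : ℝ) ^ 2) (R := R) (T := T)
      ?_ (hI.mono_set hIoi) (hI'S.mono_set hIoi) (fun i => (hLp _ (hE i)).1)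
      (fun i => (hLp _ (hE'D i)).1) (fun i => (hLp _ (hE i)).2) (fun i => (hLp _ (hE'D i)).2)
      (fun t ht => ?_) fun i hi => ?_).trans ?_
    · rw [div_le_one (by positivity)]
      nlinarith
    · calc ∑ i ∈ S, survival (E' i) t ≤ ∑ i ∈ S, 4 / (k : ℝ) ^ 2 / n :=
            Finset.sum_le_sum fun i _ => by
              rw [le_div_iff₀ hn0, mul_comm]
              exact hsmall _ (hE'D i) t ht.le
        _ = S.card * (4 / (k : ℝ) ^ 2 / n) := by simp
        _ ≤ n * (4 / (k : ℝ) ^ 2 / n) := by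
            gcongr
            exact (Finset.card_le_univ S).trans_eq (Fintype.card_fin n)
        _ = _ := by field_simp
    · rw [hE'S i hi]
      exact (hr _ (hE i)).2.2
    · have := setIntegral_mono (hI'S.mono_set hIoi) (hI'.mono_set hIoi)
        fun t => twoReach_mono E' (Finset.subset_univ S) t
      linarith
  -- At a grid point either the copies of `G` saturate, or all survival functions are small.
  have hgrid : ∀ j < k ^ 6, twoReach E S ((j + 1 : ℝ) * h)
      ≤ twoReach E' Finset.univ ((j + 1 : ℝ) * h) + 2 / k ^ 6 := by
    intro j hj
    set t : ℝ := (j + 1 : ℝ) * h with ht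
    by_cases hsat : ∃ F ∈ D, (k : ℝ) ^ 7 ≤ m * survival F t
    · have h1 : (k : ℝ) ^ 7 ≤ ∑ i ∈ Sᶜ, survival (E' i) t := by
        refine (hGsat j hj hsat).trans_eq ?_
        rw [Finset.sum_congr rfl fun i hi => by
          rw [show E' i = G from if_neg (Finset.mem_compl.1 hi)]]
        simp [hmdef, ht]
      have h2 := one_sub_le_twoReach E' Sᶜ t (one_le_pow₀ (by linarith)) h1
      have h3 := twoReach_mono E' (Finset.subset_univ Sᶜ) t
      have h4 := twoReach_le_one E S t
      have h5 : 8 / (k : ℝ) ^ 7 ≤ 2 / k ^ 6 := by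
        rw [div_le_div_iff₀ (by positivity) (by positivity)]
        have : (k : ℝ) ^ 7 = k ^ 6 * k := pow_succ _ _
        have : (0 : ℝ) < k ^ 6 := by positivity
        nlinarith
      linarith
    · push Not at hsat
      have hsm : ∀ F ∈ D, survival F t < 2 * k ^ 9 / n := fun F hF => hpm _ (hsat F hF)
      have h1 := twoReach_le_of_survival_le E E' S t (p := 2 * k ^ 9 / n) (δ := 1 / (k : ℝ) ^ 6)
        (by positivity) (fun i _ => (hsm _ (hE i)).le) (fun i _ => (hsm _ (hE'D i)).le) ?_
      · have h2 := twoReach_mono E' (Finset.subset_univ S) t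
        have h3 : 3 * ((n : ℝ) * (2 * k ^ 9 / n) ^ 2) ≤ 1 / k ^ 6 := by
          have : 3 * ((n : ℝ) * (2 * k ^ 9 / n) ^ 2) = 12 * k ^ 18 / n := by
            field_simp
            ring
          rw [this, div_le_div_iff₀ hn0 (by positivity)]
          have h6 : (k : ℝ) ^ 25 = k ^ 24 * k := pow_succ _ _
          have h7 : (k : ℝ) ^ 24 = k ^ 18 * k ^ 6 := by ring
          have h8 : (0 : ℝ) < k ^ 24 := by positivity
          nlinarith
        have h4 : 2 / (k : ℝ) ^ 6 = 1 / k ^ 6 + 1 / k ^ 6 := by ring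
        linarith
      · intro i hi
        rw [hE'S i hi]
        have hc := congrArg Fin.val (congrFun (hr _ (hE i)).2.1 ⟨j, hj⟩)
        simp only at hc
        have h5 := le_add_one_of_floor_min_eq (by
          have := survival_nonneg (r (E i)) t
          positivity) (by
          have := hsm _ (hE i)
          rw [lt_div_iff₀ hn0] at this
          push_cast
          calc (n : ℝ) * survival (E i) t * (k : ℝ) ^ 6 = survival (E i) t * n * (k : ℝ) ^ 6 := by ring
            _ < 2 * (k : ℝ) ^ 9 * (k : ℝ) ^ 6 := by gcongr
            _ = _ := by ring) hc
        have h6 : survival (r (E i)) t + 1 / (k : ℝ) ^ 6 / n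
            = (n * survival (r (E i)) t * k ^ 6 + 1) / (n * k ^ 6) := by
          field_simp
        rw [h6, le_div_iff₀ (by positivity)]
        linarith
  -- Values up to `T`.
  have hlow := integral_Ioc_le_of_grid (twoReach_antitone E S) (twoReach_antitone E' Finset.univ)
    (twoReach_nonneg E S) (twoReach_le_one E S) hh0 hgrid
  rw [← hTh] at hlow
  have hsplit : ∀ p : ℝ → ℝ, IntegrableOn p (Set.Ioi 0) →
      ∫ t in Set.Ioi 0, p t = (∫ t in Set.Ioc 0 T, p t) + ∫ t in Set.Ioi T, p t := by
    intro p hp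
    rw [← setIntegral_union (Set.Ioc_disjoint_Ioi le_rfl) measurableSet_Ioi
      (hp.mono_set Set.Ioc_subset_Ioi_self) (hp.mono_set hIoi), Set.Ioc_union_Ioi_eq_Ioi hT0.le]
  rw [hER, hsplit _ hI] at hl
  rw [hsplit _ hI']
  exact le_of_error_le hkr hknr hR hl htail hlow

/-! ### Infinite revenue, few bidders, and the size of the bound -/

theorem exists_spRevenue_eq_ideal (n : ℕ) {D : Finset (ProbabilityMeasure ℝ≥0)}
    (hD : D.Nonempty) :
    ∃ E : Economy n, (∀ i, E i ∈ D) ∧ E.spRevenue = idealSpRevenue n D := by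
  classical
  obtain ⟨F, hF⟩ := hD
  obtain ⟨E, hE, hmax⟩ := Finset.exists_max_image (Fintype.piFinset fun _ : Fin n => D)
    Economy.spRevenue ⟨fun _ => F, Fintype.mem_piFinset.2 fun _ => hF⟩
  have hE' := Fintype.mem_piFinset.1 hE
  exact ⟨E, hE', le_antisymm (le_iSup₂ (f := fun (E : Economy n) (_ : ∀ i, E i ∈ D) => E.spRevenue)
    E hE') (iSup₂_le fun E'' h => hmax E'' (Fintype.mem_piFinset.2 h))⟩

theorem spRevenue_ne_top_iff {n : ℕ} (E : Economy n) :
    E.spRevenue ≠ ∞ ↔ IntegrableOn (twoReach E Finset.univ) (Set.Ioi 0) := by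
  rw [spRevenue_eq]
  exact lintegral_ofReal_ne_top_iff_integrable
    (twoReach_antitone E _).measurable.aestronglyMeasurable
    (Filter.Eventually.of_forall fun t => twoReach_nonneg _ _ _)

theorem spRevenue_eq_ofReal {n : ℕ} {E : Economy n}
    (hE : IntegrableOn (twoReach E Finset.univ) (Set.Ioi 0)) :
    E.spRevenue = ENNReal.ofReal (∫ t in Set.Ioi 0, twoReach E Finset.univ t) := by
  rw [spRevenue_eq, ofReal_integral_eq_lintegral_ofReal hE
    (Filter.Eventually.of_forall fun t => twoReach_nonneg _ _ _)]

/-- An economy has finite revenue as soon as, for each of its distributions, the economy made of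
copies of it does. -/
theorem integrableOn_twoReach_of_copies {n : ℕ} (hn : 24 ≤ n) (E : Economy n)
    (h : ∀ i, IntegrableOn (twoReach (fun _ : Fin n => E i) Finset.univ) (Set.Ioi 0)) :
    IntegrableOn (twoReach E Finset.univ) (Set.Ioi 0) := by
  have hn' : (24 : ℝ) ≤ n := by exact_mod_cast hn
  refine Integrable.mono'
    ((integrable_finsetSum Finset.univ fun i _ => h i).const_mul (12 * (n : ℝ)))
    (twoReach_antitone E _).measurable.aestronglyMeasurable
    (Filter.Eventually.of_forall fun t => ?_)
  rw [Real.norm_of_nonneg (twoReach_nonneg _ _ _)]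
  have h1 := twoReach_le_poissonTwo_add E Finset.univ t
  have h2 := poissonTwo_le_sq (x := ∑ i, survival (E i) t)
    (Finset.sum_nonneg fun i _ => survival_nonneg _ _)
  have h3 : (∑ i, survival (E i) t) ^ 2 ≤ n * ∑ i, survival (E i) t ^ 2 := by
    simpa using sq_sum_le_card_mul_sum_sq (s := (Finset.univ : Finset (Fin n)))
      (f := fun i => survival (E i) t)
  have h4 : ∑ i, survival (E i) t ^ 2
      ≤ 12 * ∑ i, twoReach (fun _ : Fin n => E i) Finset.univ t := by
    rw [Finset.mul_sum]
    refine Finset.sum_le_sum fun i _ => ?_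
    have h5 := min_sq_le_twoReach hn (E i) t
    have h0 := survival_nonneg (E i) t
    have h6 : survival (E i) t ^ 2 ≤ min 1 ((n * survival (E i) t) ^ 2) :=
      le_min (pow_le_one₀ h0 (survival_le_one _ _)) (pow_le_pow_left₀ h0 (by nlinarith) 2)
    linarith
  have h7 : 0 ≤ ∑ i, survival (E i) t ^ 2 := Finset.sum_nonneg fun i _ => sq_nonneg _
  calc twoReach E Finset.univ t ≤ n * ∑ i, survival (E i) t ^ 2 := by nlinarith
    _ ≤ n * (12 * ∑ i, twoReach (fun _ : Fin n => E i) Finset.univ t) := by gcongr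
    _ = _ := by ring

/-- A bounded number of distributions suffices up to the factor `1 - 1 / k`. -/
theorem exists_small_subset {k : ℕ} (hk : 30 ≤ k) (n : ℕ)
    {D : Finset (ProbabilityMeasure ℝ≥0)} (hD : D.Nonempty) :
    ∃ D' ⊆ D, D'.card ≤ k ^ k ^ 7 ∧ ∃ E : Economy n, (∀ i, E i ∈ D') ∧
      ENNReal.ofReal (1 - 1 / (k : ℝ)) * idealSpRevenue n D ≤ E.spRevenue := by
  classical
  have hk0 : 0 < k := by omega
  have hfac : ENNReal.ofReal (1 - 1 / (k : ℝ)) ≤ 1 := by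
    rw [ENNReal.ofReal_le_one]
    have : (0 : ℝ) ≤ 1 / k := by positivity
    linarith
  have hsingle : ∀ F ∈ D, idealSpRevenue n D ≤ Economy.spRevenue (fun _ : Fin n => F) →
      ∃ D' ⊆ D, D'.card ≤ k ^ k ^ 7 ∧ ∃ E : Economy n, (∀ i, E i ∈ D') ∧
        ENNReal.ofReal (1 - 1 / (k : ℝ)) * idealSpRevenue n D ≤ E.spRevenue := fun F hF h =>
    ⟨{F}, Finset.singleton_subset_iff.2 hF, by
      rw [Finset.card_singleton]
      exact Nat.one_le_pow _ _ hk0, fun _ => F, fun _ => Finset.mem_singleton_self F,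
      (mul_le_of_le_one_left' hfac).trans h⟩
  obtain ⟨E, hE, hEI⟩ := exists_spRevenue_eq_ideal n hD
  rcases lt_or_ge n (k ^ 25) with hn | hn
  · refine ⟨Finset.univ.image E, ?_, ?_, E, fun i => Finset.mem_image_of_mem E (Finset.mem_univ i),
      ?_⟩
    · intro F hF
      obtain ⟨i, -, rfl⟩ := Finset.mem_image.1 hF
      exact hE i
    · have h1 : (Finset.univ.image E).card ≤ n :=
        Finset.card_image_le.trans_eq (by simp)
      have h2 : 25 ≤ k ^ 7 := le_trans (by omega) (Nat.le_self_pow (by norm_num) k)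
      exact h1.trans (hn.le.trans (Nat.pow_le_pow_right hk0 h2))
    · rw [hEI]
      exact mul_le_of_le_one_left' hfac
  by_cases htop : ∃ F ∈ D, Economy.spRevenue (fun _ : Fin n => F) = ∞
  · obtain ⟨F, hF, h⟩ := htop
    exact hsingle F hF (h ▸ le_top)
  push Not at htop
  have hn24 : 24 ≤ n := by
    have : k ≤ k ^ 25 := Nat.le_self_pow (by norm_num) k
    omega
  have hint : ∀ E : Economy n, (∀ i, E i ∈ D) →
      IntegrableOn (twoReach E Finset.univ) (Set.Ioi 0) := fun E hE =>
    integrableOn_twoReach_of_copies hn24 E fun i => (spRevenue_ne_top_iff _).1 (htop _ (hE i))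
  have hI : idealSpRevenue n D
      = ENNReal.ofReal (∫ t in Set.Ioi 0, twoReach E Finset.univ t) := by
    rw [← hEI, spRevenue_eq_ofReal (hint E hE)]
  set R := ∫ t in Set.Ioi 0, twoReach E Finset.univ t with hR
  have hR0 : 0 ≤ R := integral_nonneg fun t => twoReach_nonneg _ _ _
  rcases hR0.eq_or_lt with h0 | h0
  · obtain ⟨F, hF⟩ := hD
    refine hsingle F hF ?_
    rw [hI, ← h0]
    simp
  have hle : ∀ E : Economy n, (∀ i, E i ∈ D) →
      ∫ t in Set.Ioi 0, twoReach E Finset.univ t ≤ R := fun E' hE' => by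
    refine (ENNReal.ofReal_le_ofReal_iff hR0).1 ?_
    rw [← hI, ← spRevenue_eq_ofReal (hint E' hE')]
    exact le_iSup₂ (f := fun (E : Economy n) (_ : ∀ i, E i ∈ D) => E.spRevenue) E' hE'
  obtain ⟨D', hD', hcard, E', hE', hrev⟩ := exists_small_of_integrable hk hn hD h0 hint hle E hE rfl
  refine ⟨D', hD', hcard, E', hE', ?_⟩
  have h1 : (1 : ℝ) / k ≤ 1 := by
    rw [div_le_one (by positivity)]
    exact_mod_cast hk0
  rw [hI, ← ENNReal.ofReal_mul (by linarith),
    spRevenue_eq_ofReal (hint E' fun i => hD' (hE' i))]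
  exact ENNReal.ofReal_le_ofReal hrev

/-- The accuracy parameter for `ε`. -/
def accuracy (ε : ℝ) : ℕ := max 30 ⌈1 / ε⌉₊

/-- The exponent for which `(1 / ε) ^ exponent ε = k ^ k ^ 7`, with `k = accuracy ε`, when `ε < 1`.
For `1 ≤ ε` it is `0`. -/
def exponent (ε : ℝ) : ℝ :=
  if ε < 1 then (accuracy ε : ℝ) ^ 7 * Real.log (accuracy ε) / Real.log (1 / ε) else 0

theorem rpow_exponent {ε : ℝ} (h0 : 0 < ε) (h1 : ε < 1) :
    (1 / ε) ^ exponent ε = (accuracy ε : ℝ) ^ accuracy ε ^ 7 := by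
  have hlog : 0 < Real.log (1 / ε) := Real.log_pos (by rwa [lt_div_iff₀ h0, one_mul])
  have hk : (0 : ℝ) < accuracy ε := by
    exact_mod_cast lt_of_lt_of_le (by norm_num) (le_max_left 30 ⌈1 / ε⌉₊)
  rw [exponent, if_pos h1, Real.rpow_def_of_pos (by positivity), mul_div_cancel₀ _ hlog.ne',
    mul_comm, Real.exp_mul, Real.exp_log hk]
  exact_mod_cast Real.rpow_natCast (accuracy ε : ℝ) (accuracy ε ^ 7)

theorem exponent_isBigO : exponent =O[𝓝[>] (0 : ℝ)] fun ε : ℝ => 1 / ε ^ 10 := by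
  refine IsBigO.of_bound 256 ?_
  filter_upwards [Ioo_mem_nhdsGT (show (0 : ℝ) < 1 / 30 by norm_num)] with ε hε
  obtain ⟨h0, h1⟩ := hε
  have hinv : 30 ≤ 1 / ε := by
    rw [le_div_iff₀ h0]
    linarith
  have hk30 : (30 : ℝ) ≤ accuracy ε := by exact_mod_cast le_max_left 30 ⌈1 / ε⌉₊
  have hk : (accuracy ε : ℝ) ≤ 2 * (1 / ε) := by
    have h2 := Nat.ceil_lt_add_one (a := 1 / ε) (by positivity)
    rw [accuracy, Nat.cast_max]
    exact max_le (by push_cast; linarith) (by linarith)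
  have hlog : 0 < Real.log (1 / ε) := Real.log_pos (by linarith)
  have hlogk : Real.log (accuracy ε) ≤ 2 * Real.log (1 / ε) := by
    rw [← Nat.cast_two, ← Real.log_pow]
    exact Real.log_le_log (by linarith) (by nlinarith)
  have hlogk0 : 0 ≤ Real.log (accuracy ε) := Real.log_nonneg (by linarith)
  rw [exponent, if_pos (by linarith), Real.norm_of_nonneg (by positivity),
    Real.norm_of_nonneg (by positivity)]
  calc (accuracy ε : ℝ) ^ 7 * Real.log (accuracy ε) / Real.log (1 / ε)
      ≤ (2 * (1 / ε)) ^ 7 * (2 * Real.log (1 / ε)) / Real.log (1 / ε) := by gcongr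
    _ = 256 * (1 / ε) ^ 7 := by field_simp; norm_num
    _ ≤ 256 * (1 / ε) ^ 10 := by
        gcongr
        · linarith
        · norm_num
    _ = _ := by rw [one_div_pow]

end

theorem theorem3 :
    ∃ g : ℝ → ℝ, (g =O[𝓝[>] (0 : ℝ)] fun ε : ℝ => 1 / ε ^ 10) ∧
      ∀ ε : ℝ, 0 < ε →
        ∀ (n : ℕ) (D : Finset (ProbabilityMeasure ℝ≥0)), D.Nonempty →
          ∃ D' ⊆ D, (D'.card : ℝ) ≤ (1 / ε) ^ g ε ∧
            ∃ E : Economy n, (∀ i, E i ∈ D') ∧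
              ENNReal.ofReal (1 - ε) * idealSpRevenue n D ≤ E.spRevenue := by
  refine ⟨exponent, exponent_isBigO, fun ε hε n D hD => ?_⟩
  rcases lt_or_ge ε 1 with h1 | h1
  · obtain ⟨D', hD', hcard, E, hE, hrev⟩ := exists_small_subset (le_max_left 30 ⌈1 / ε⌉₊) n hD
    refine ⟨D', hD', ?_, E, hE, le_trans ?_ hrev⟩
    · rw [rpow_exponent hε h1]
      exact_mod_cast hcard
    · gcongr
      rw [one_div_le (by positivity) hε]
      exact (Nat.le_ceil _).trans (by exact_mod_cast le_max_right 30 ⌈1 / ε⌉₊)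
  · obtain ⟨F, hF⟩ := hD
    refine ⟨{F}, Finset.singleton_subset_iff.2 hF, ?_, fun _ => F,
      fun _ => Finset.mem_singleton_self F, ?_⟩
    · simp [exponent, not_lt.2 h1]
    · rw [ENNReal.ofReal_of_nonpos (by linarith), zero_mul]
      exact zero_le
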